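/- Proposition (Periodic Clustering). Let $A\ge 0$, $\Pi_0\ge 0$, $\sigma^2>0$. Let $s(x)$, $x\ge 0$, be the stationary solution of $ds/dx=-A\,s+B\,u$ ($u$ white Gaussian noise, $s(0)\sim\mathcal N(0,\Pi_0)$), i.e. the centered Gaussian field with $\mathbb E[s(x)s(x')]=\Pi_0e^{-A|x-x'|}$. Sensors at locations $x_1,\dots,x_n$ (not necessarily distinct) observe $y_i=w_i$ under $H_0$ and $y_i=s(x_i)+w_i$ under $H_1$, where the $w_i\sim\mathcal N(0,\sigma^2)$ are i.i.d. and independent of $s$; put $\mathrm{SNR}=\Pi_0/\sigma^2$. For $\alpha\in(0,1)$ let $P_M(x_1,\dots,x_n;\alpha)$ be the miss probability of the Neyman–Pearson detector of level $\alpha$, i.e. the least probability, under $H_1$, of deciding $H_0$ among all tests that decide $H_1$ with probability at most $\alpha$ under $H_0$. For every $A\ge0$ there is a function $K(\cdot\,;\cdot)$ such that the following hold for all $\Delta>0$, $\Pi_0\ge0$, $\sigma^2>0$ and $\alpha\in(0,1)$. (Uniform configuration.) For $n$ sensors at $0,\Delta,\dots,(n-1)\Delta$ the error exponent exists, does not depend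 on $\alpha$, and depends on $(\Pi_0,\sigma^2)$ through $\mathrm{SNR}$ only: $$\lim_{n\to\infty}-\frac1n\log P_M\bigl(0,\Delta,\dots,(n-1)\Delta;\alpha\bigr)=K(\Delta;\mathrm{SNR}).$$ (Periodic clustering.) Let $M\ge1$ and $\tilde\Delta=M\Delta$. For $n=MN$ sensors placed in $N$ clusters of $M$ co-located sensors each, the clusters being at $0,\tilde\Delta,\dots,(N-1)\tilde\Delta$, the error exponent exists and is $$\tilde K=\lim_{N\to\infty}-\frac1{MN}\log P_M=\frac1M\,K(\tilde\Delta;\,M\cdot\mathrm{SNR}).$$ -/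

import Mathlib

open MeasureTheory ProbabilityTheory
open scoped NNReal

namespace SensorField

/-- Covariance matrix of the samples `s (x i)`, `i : ι`, of the stationary solution of
`ds/dx = - A s + B u` with `s (0) ∼ N(0, Pi0)`, that is, of the centered stationary Gaussian field
with `E[s (x) s (x')] = Pi0 * exp (-A |x - x'|)`. -/
noncomputable def signalCov {ι : Type*} (A : ℝ) (Pi0 : ℝ≥0) (x : ι → ℝ) : Matrix ι ι ℝ :=
  Matrix.of fun i j => (Pi0 : ℝ) * Real.exp (-A * |x i - x j|)

/-- The matrix `signalCov A Pi0 x` is a covariance matrix for all locations, repeated ones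
included; so `multivariateGaussian` is used below on its proper domain only. -/
theorem posSemidef_signalCov {ι : Type*} [Fintype ι] [DecidableEq ι] {A : ℝ} (hA : 0 ≤ A)
    (Pi0 : ℝ≥0) (x : ι → ℝ) : (signalCov A Pi0 x).PosSemidef := by
  have h := posSemidef_matrix_measure_inter (μ := (volume : Measure ℝ))
    (s := fun i : ι => Set.Icc 0 (Real.exp (2 * A * x i)))
    (fun _ => measurableSet_Icc) (fun _ => isCompact_Icc.measure_ne_top)
  have h2 := h.conjTranspose_mul_mul_same
    (Matrix.diagonal fun i => Real.sqrt Pi0 * Real.exp (-A * x i))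
  convert h2 using 1
  ext i j
  have hs : Real.sqrt (Pi0 : ℝ) * Real.sqrt (Pi0 : ℝ) = Pi0 :=
    Real.mul_self_sqrt Pi0.coe_nonneg
  have key : Real.exp (-A * |x i - x j|)
      = Real.exp (-A * x i) * min (Real.exp (2 * A * x i)) (Real.exp (2 * A * x j))
        * Real.exp (-A * x j) := by
    rcases le_total (x i) (x j) with hij | hij
    · rw [min_eq_left (Real.exp_le_exp.2 (by gcongr)), ← Real.exp_add, ← Real.exp_add,
        abs_of_nonpos (by linarith)]
      congr 1; ring
    · rw [min_eq_right (Real.exp_le_exp.2 (by gcongr)), ← Real.exp_add, ← Real.exp_add,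
        abs_of_nonneg (by linarith)]
      congr 1; ring
  have hpos : 0 ≤ min (Real.exp (2 * A * x i)) (Real.exp (2 * A * x j)) :=
    le_min (Real.exp_pos _).le (Real.exp_pos _).le
  simp only [signalCov, Matrix.of_apply, Matrix.diagonal_conjTranspose, Matrix.diagonal_mul,
    Matrix.mul_diagonal, Set.Icc_inter_Icc, max_self, Real.volume_real_Icc,
    star_trivial, sub_zero, key]
  rw [max_eq_left hpos]
  linear_combination (-(Real.exp (-A * x i) *
    min (Real.exp (2 * A * x i)) (Real.exp (2 * A * x j)) * Real.exp (-A * x j))) * hs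

/-- Joint law of the signal samples `s (x i)`, `i : ι`. -/
noncomputable def signalLaw {ι : Type*} [Fintype ι] [DecidableEq ι] (A : ℝ) (Pi0 : ℝ≥0)
    (x : ι → ℝ) : Measure (ι → ℝ) :=
  (multivariateGaussian (0 : EuclideanSpace ℝ ι) (signalCov A Pi0 x)).map WithLp.ofLp

/-- Law of the observations under `H₀ : y i = w i`, with independent `w i ∼ N(0, σ2)`. -/
noncomputable def lawH0 (ι : Type*) [Fintype ι] (σ2 : ℝ≥0) : Measure (ι → ℝ) :=
  Measure.pi fun _ => gaussianReal 0 σ2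

/-- Law of the observations under `H₁ : y i = s (x i) + w i`, with signal and noise
independent. -/
noncomputable def lawH1 {ι : Type*} [Fintype ι] [DecidableEq ι] (A : ℝ) (Pi0 σ2 : ℝ≥0)
    (x : ι → ℝ) : Measure (ι → ℝ) :=
  ((signalLaw A Pi0 x).prod (lawH0 ι σ2)).map fun p => p.1 + p.2

/-- A (randomized) test: `φ y` is the probability of deciding `H₁` on observing `y`. -/
def IsTest {X : Type*} [MeasurableSpace X] (φ : X → ℝ) : Prop :=
  Measurable φ ∧ ∀ y, φ y ∈ Set.Icc (0 : ℝ) 1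

/-- Miss probability of the Neyman-Pearson detector of level `α` for `P0` against `P1`: the least
miss probability among all tests whose false-alarm probability is at most `α`. -/
noncomputable def npMissProb {X : Type*} [MeasurableSpace X] (P0 P1 : Measure X) (α : ℝ) : ℝ :=
  sInf {β | ∃ φ : X → ℝ, IsTest φ ∧ ∫ y, φ y ∂P0 ≤ α ∧ β = ∫ y, (1 - φ y) ∂P1}

/-- Miss probability of the Neyman-Pearson detector of level `α` with sensors at the locations
`x i`, `i : ι`. -/
noncomputable def missProb {ι : Type*} [Fintype ι] [DecidableEq ι] (A : ℝ) (Pi0 σ2 : ℝ≥0)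
    (x : ι → ℝ) (α : ℝ) : ℝ :=
  npMissProb (lawH0 ι σ2) (lawH1 A Pi0 σ2 x) α

/-- Uniform configuration: `n` sensors at `0, Δ, …, (n - 1) Δ`. -/
def uniformLoc (Δ : ℝ) (n : ℕ) : Fin n → ℝ := fun i => (i : ℝ) * Δ

/-- Periodic clustering: `N` clusters, at `0, Δ', …, (N - 1) Δ'`, of `M` co-located sensors
each. -/
def clusterLoc (Δ' : ℝ) (N M : ℕ) : Fin N × Fin M → ℝ := fun k => (k.1 : ℝ) * Δ'

/-- `K` is the error exponent (per sensor) of the miss probability at level `α` for uniform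
configuration with spacing `Δ`. -/
def IsUniformExponent (A : ℝ) (Pi0 σ2 : ℝ≥0) (Δ α K : ℝ) : Prop :=
  Filter.Tendsto
    (fun n : ℕ => -(1 / (n : ℝ)) * Real.log (missProb A Pi0 σ2 (uniformLoc Δ n) α))
    Filter.atTop (nhds K)

/-- `K` is the error exponent (per sensor, with `M * N` sensors) of the miss probability at level
`α` for clusters of `M` co-located sensors with inter-cluster spacing `Δ'`. -/
def IsClusterExponent (A : ℝ) (Pi0 σ2 : ℝ≥0) (M : ℕ) (Δ' α K : ℝ) : Prop :=
  Filter.Tendsto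
    (fun N : ℕ => -(1 / ((M : ℝ) * (N : ℝ))) *
      Real.log (missProb A Pi0 σ2 (clusterLoc Δ' N M) α))
    Filter.atTop (nhds K)

end SensorField

/-!
By Stein's lemma the error exponent is the limit of the Kullback-Leibler divergence of `H₀` from
`H₁` per sensor: the log-likelihood ratio has that mean and, in the coordinates which diagonalize
the signal covariance, it is a sum of independent terms of bounded variance. In units of `σ2` the
divergence is `(log det S + tr S⁻¹ - n) / 2` for `S = 1 + X`, with `X` the covariance matrix of the
signal divided by `σ2`. Along a uniform configuration `log det S` is subadditive (Fischer's
inequality) and `tr S⁻¹` is superadditive, as the blocks of `S` along the diagonal are again of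
this form by stationarity, so Fekete's lemma yields the limit.

A cluster of `M` co-located sensors acts as one sensor with `M` times the signal-to-noise ratio:
`X = B * C` with `B` the incidence matrix between sensors and clusters, `C * B` is `M` times the
normalized signal covariance of one sensor per cluster, and `det (1 + B * C)` and
`tr (1 + B * C)⁻¹ - n` do not change when `B` and `C` are swapped.
-/

namespace SensorField

open Filter Topology
open scoped Matrix

section Divergence

open Matrix

variable {m n : Type*} [Fintype m] [DecidableEq m] [Fintype n] [DecidableEq n]

theorem inv_one_add_mul {R : Type*} [CommRing R] (B : Matrix m n R) (C : Matrix n m R)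
    (h : IsUnit (1 + C * B).det) : (1 + B * C)⁻¹ = 1 - B * (1 + C * B)⁻¹ * C := by
  have h' : IsUnit ((1 : Matrix n n R)⁻¹ + C * (1 : Matrix m m R)⁻¹ * B) := by
    simpa [isUnit_iff_isUnit_det] using h
  simpa using add_mul_mul_inv_eq_sub (1 : Matrix m m R) B 1 C isUnit_one isUnit_one h'

theorem trace_inv_one_add_mul_comm {R : Type*} [CommRing R] (B : Matrix m n R)
    (C : Matrix n m R) (h : IsUnit (1 + C * B).det) :
    trace (1 + B * C)⁻¹ - (Fintype.card m : R) = trace (1 + C * B)⁻¹ - (Fintype.card n : R) := by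
  have hsplit : (1 + C * B)⁻¹ * (C * B) = 1 - (1 + C * B)⁻¹ := by
    rw [eq_sub_iff_add_eq']
    simpa only [Matrix.mul_add, Matrix.mul_one] using nonsing_inv_mul _ h
  rw [inv_one_add_mul B C h, trace_sub, trace_one, Matrix.mul_assoc, trace_mul_comm,
    Matrix.mul_assoc, hsplit, trace_sub, trace_one]
  ring

/-- The Kullback-Leibler divergence of `N(0, 1)` from the centered Gaussian law with covariance
matrix `S`, in closed form. It is the mean of the log-likelihood ratio under `H₀`. -/
noncomputable def gaussianDivergence (S : Matrix n n ℝ) : ℝ :=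
  1 / 2 * (Real.log S.det + S⁻¹.trace - Fintype.card n)

theorem gaussianDivergence_one_add_mul_comm (B : Matrix m n ℝ) (C : Matrix n m ℝ)
    (h : IsUnit (1 + C * B).det) :
    gaussianDivergence (1 + B * C) = gaussianDivergence (1 + C * B) := by
  rw [gaussianDivergence, gaussianDivergence, det_one_add_mul_comm, add_sub_assoc,
    trace_inv_one_add_mul_comm B C h, add_sub_assoc]

theorem gaussianDivergence_diagonal {v : n → ℝ} (hv : ∀ i, v i ≠ 0) :
    gaussianDivergence (diagonal v) = ∑ i, 1 / 2 * (Real.log (v i) - (1 - (v i)⁻¹)) := by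
  have hinv : (diagonal v)⁻¹ = diagonal fun i => (v i)⁻¹ := by
    refine inv_eq_right_inv ?_
    rw [diagonal_mul_diagonal, ← diagonal_one]
    simp only [mul_inv_cancel₀ (hv _)]
  rw [gaussianDivergence, det_diagonal, hinv, trace_diagonal, Real.log_prod fun i _ => hv i,
    ← Finset.mul_sum, Finset.sum_sub_distrib, Finset.sum_sub_distrib]
  simp only [Finset.sum_const, Finset.card_univ, nsmul_eq_mul, mul_one]
  ring

end Divergence

section MatrixInequalities

open Matrix

variable {m n : Type*} [Fintype m] [DecidableEq m] [Fintype n] [DecidableEq n]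

theorem posDef_one_add {k : Type*} [DecidableEq k] {X : Matrix k k ℝ} (hX : X.PosSemidef) :
    (1 + X).PosDef :=
  PosDef.one.add_posSemidef hX

theorem exists_eq_conjTranspose_mul_self {k : Type*} [Fintype k] {X : Matrix k k ℝ}
    (hX : X.PosSemidef) : ∃ C : Matrix k k ℝ, X = Cᴴ * C := by
  classical
  open scoped MatrixOrder in
  exact CStarAlgebra.nonneg_iff_eq_star_mul_self.mp hX.nonneg

theorem trace_inv_one_add_le_card {X : Matrix n n ℝ} (hX : X.PosSemidef) :
    (1 + X)⁻¹.trace ≤ Fintype.card n := by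
  obtain ⟨C, rfl⟩ := exists_eq_conjTranspose_mul_self hX
  have hpd := posDef_one_add (posSemidef_self_mul_conjTranspose C)
  rw [inv_one_add_mul _ _ hpd.det_pos.ne'.isUnit, trace_sub, trace_one]
  exact sub_le_self _ (hpd.inv.posSemidef.conjTranspose_mul_mul_same C).trace_nonneg

theorem det_le_exp_trace_sub_card {G : Matrix n n ℝ} (hG : G.PosSemidef) :
    G.det ≤ Real.exp (G.trace - Fintype.card n) := by
  have hdet : G.det = ∏ i, hG.1.eigenvalues i := by simpa using hG.1.det_eq_prod_eigenvalues
  have htrace : G.trace - Fintype.card n = ∑ i, (hG.1.eigenvalues i - 1) := by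
    have := hG.1.trace_eq_sum_eigenvalues
    simp_all
  rw [hdet, htrace, Real.exp_sum]
  refine Finset.prod_le_prod (fun i _ => hG.eigenvalues_nonneg i) fun i _ => ?_
  simpa using Real.add_one_le_exp (hG.1.eigenvalues i - 1)

theorem card_sub_trace_inv_le_log_det {S : Matrix n n ℝ} (hS : S.PosDef) :
    Fintype.card n - S⁻¹.trace ≤ Real.log S.det := by
  have h := det_le_exp_trace_sub_card hS.inv.posSemidef
  rw [det_nonsing_inv, Ring.inverse_eq_inv', ← Real.log_le_iff_le_exp (inv_pos.2 hS.det_pos),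
    Real.log_inv] at h
  linarith

theorem det_le_det_of_trace_inv_mul_le {E F : Matrix n n ℝ} (hE : E.PosDef) (hF : F.PosSemidef)
    (h : (E⁻¹ * F).trace ≤ Fintype.card n) : F.det ≤ E.det := by
  obtain ⟨C, hC⟩ := exists_eq_conjTranspose_mul_self hE.inv.posSemidef
  have htrace : (C * F * Cᴴ).trace = (E⁻¹ * F).trace := by
    rw [trace_mul_comm, ← Matrix.mul_assoc, ← hC]
  have hdet : (C * F * Cᴴ).det = F.det / E.det := by
    rw [det_mul_comm, ← Matrix.mul_assoc, ← hC, det_mul, det_nonsing_inv, Ring.inverse_eq_inv',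
      inv_mul_eq_div]
  have hle := det_le_exp_trace_sub_card (hF.mul_mul_conjTranspose_same C)
  rw [hdet, htrace, div_le_iff₀ hE.det_pos] at hle
  refine hle.trans (mul_le_of_le_one_left hE.det_pos.le (Real.exp_le_one_iff.2 ?_))
  linarith

theorem trace_inv_le_trace_inv_of_trace_le {E F : Matrix n n ℝ} (hE : E.IsHermitian)
    (hF : F.PosDef) (h : (E⁻¹ * F * E⁻¹).trace ≤ E⁻¹.trace) : E⁻¹.trace ≤ F⁻¹.trace := by
  have hu := hF.det_pos.ne'.isUnit
  have hnonneg := (hF.posSemidef.mul_mul_conjTranspose_same (F⁻¹ - E⁻¹)).trace_nonneg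
  have hexpand : (F⁻¹ - E⁻¹) * F * (F⁻¹ - E⁻¹) = F⁻¹ - E⁻¹ - E⁻¹ + E⁻¹ * F * E⁻¹ := by
    rw [Matrix.sub_mul, nonsing_inv_mul _ hu, Matrix.sub_mul, Matrix.one_mul, Matrix.mul_sub,
      mul_nonsing_inv_cancel_right _ _ hu]
    abel
  rw [(hF.inv.1.sub hE.inv).eq, hexpand, trace_add, trace_sub, trace_sub] at hnonneg
  linarith

theorem trace_eq_trace_toBlocks_add {k l R : Type*} [Fintype k] [Fintype l] [AddCommMonoid R]
    (S : Matrix (k ⊕ l) (k ⊕ l) R) : S.trace = S.toBlocks₁₁.trace + S.toBlocks₂₂.trace :=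
  Fintype.sum_sum_type _

theorem posDef_fromBlocks_zero {k l : Type*} [Finite k] [Finite l] {P : Matrix k k ℝ}
    {D : Matrix l l ℝ} (hP : P.PosDef) (hD : D.PosDef) : (fromBlocks P 0 0 D).PosDef := by
  classical
  have := Fintype.ofFinite k
  have := Fintype.ofFinite l
  have := hP.isUnit.invertible
  have h := (hP.fromBlocks₁₁ (0 : Matrix k l ℝ) D).2 (by simpa using hD.posSemidef)
  rw [conjTranspose_zero] at h
  rw [h.posDef_iff_det_ne_zero, det_fromBlocks_zero₂₁]
  exact mul_ne_zero hP.det_pos.ne' hD.det_pos.ne'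

theorem inv_fromBlocks_zero {R : Type*} [CommRing R] {P : Matrix m m R} {D : Matrix n n R}
    (hP : IsUnit P.det) (hD : IsUnit D.det) :
    (fromBlocks P 0 0 D)⁻¹ = fromBlocks P⁻¹ 0 0 D⁻¹ := by
  have hPD : IsUnit P ↔ IsUnit D := by simp [isUnit_iff_isUnit_det, hP, hD]
  simp [inv_fromBlocks_zero₂₁_of_isUnit_iff _ _ _ hPD]

section Blocks

variable {S : Matrix (m ⊕ n) (m ⊕ n) ℝ}

/-- **Fischer's inequality**. -/
theorem det_le_det_toBlocks_mul (hS : S.PosDef) :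
    S.det ≤ S.toBlocks₁₁.det * S.toBlocks₂₂.det := by
  have hP : S.toBlocks₁₁.PosDef := hS.submatrix Sum.inl_injective
  have hD : S.toBlocks₂₂.PosDef := hS.submatrix Sum.inr_injective
  rw [← det_fromBlocks_zero₂₁ S.toBlocks₁₁ 0 S.toBlocks₂₂]
  refine det_le_det_of_trace_inv_mul_le (posDef_fromBlocks_zero hP hD) hS.posSemidef (le_of_eq ?_)
  rw [inv_fromBlocks_zero hP.det_pos.ne'.isUnit hD.det_pos.ne'.isUnit]
  nth_rw 3 [← fromBlocks_toBlocks S]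
  simp [fromBlocks_multiply, trace_eq_trace_toBlocks_add, nonsing_inv_mul _ hP.det_pos.ne'.isUnit,
    nonsing_inv_mul _ hD.det_pos.ne'.isUnit]

theorem trace_inv_toBlocks_add_le (hS : S.PosDef) :
    S.toBlocks₁₁⁻¹.trace + S.toBlocks₂₂⁻¹.trace ≤ S⁻¹.trace := by
  have hP : S.toBlocks₁₁.PosDef := hS.submatrix Sum.inl_injective
  have hD : S.toBlocks₂₂.PosDef := hS.submatrix Sum.inr_injective
  have hinv := inv_fromBlocks_zero hP.det_pos.ne'.isUnit hD.det_pos.ne'.isUnit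
  have h := trace_inv_le_trace_inv_of_trace_le (posDef_fromBlocks_zero hP hD).1 hS (le_of_eq ?_)
  · simpa [hinv, trace_eq_trace_toBlocks_add] using h
  rw [hinv]
  nth_rw 3 [← fromBlocks_toBlocks S]
  simp [fromBlocks_multiply, trace_eq_trace_toBlocks_add, nonsing_inv_mul _ hP.det_pos.ne'.isUnit,
    nonsing_inv_mul _ hD.det_pos.ne'.isUnit]

end Blocks

end MatrixInequalities

section StationaryCovariance

open Matrix

/-- The `n × n` upper left corner of the infinite matrix `c`. -/
def leadingBlock {R : Type*} (c : Matrix ℕ ℕ R) (n : ℕ) : Matrix (Fin n) (Fin n) R :=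
  c.submatrix Fin.val Fin.val

theorem leadingBlock_one_add {R : Type*} [AddMonoidWithOne R] (c : Matrix ℕ ℕ R) (n : ℕ) :
    leadingBlock (1 + c) n = 1 + leadingBlock c n := by
  ext i j
  simp [leadingBlock, Matrix.one_apply, Fin.ext_iff]

theorem toBlocks₁₁_leadingBlock_add {R : Type*} (c : Matrix ℕ ℕ R) (k l : ℕ) :
    ((leadingBlock c (k + l)).submatrix finSumFinEquiv finSumFinEquiv).toBlocks₁₁
      = leadingBlock c k := by
  ext i j
  simp [leadingBlock, toBlocks₁₁]

theorem toBlocks₂₂_leadingBlock_add {R : Type*} {c : Matrix ℕ ℕ R}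
    (hc : ∀ k i j, c (k + i) (k + j) = c i j) (k l : ℕ) :
    ((leadingBlock c (k + l)).submatrix finSumFinEquiv finSumFinEquiv).toBlocks₂₂
      = leadingBlock c l := by
  ext i j
  simp [leadingBlock, toBlocks₂₂, hc]

section Subadditive

variable {c : Matrix ℕ ℕ ℝ} (hc : ∀ k i j, c (k + i) (k + j) = c i j)
include hc

theorem subadditive_log_det_leadingBlock (hpd : ∀ n, (leadingBlock c n).PosDef) :
    Subadditive fun n => Real.log (leadingBlock c n).det := by
  intro k l
  have h := det_le_det_toBlocks_mul
    ((hpd (k + l)).submatrix (e := finSumFinEquiv) finSumFinEquiv.injective)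
  rw [toBlocks₁₁_leadingBlock_add, toBlocks₂₂_leadingBlock_add hc, det_submatrix_equiv_self] at h
  rw [← Real.log_mul (hpd k).det_pos.ne' (hpd l).det_pos.ne']
  exact Real.log_le_log (hpd (k + l)).det_pos h

theorem subadditive_neg_trace_inv_leadingBlock (hpd : ∀ n, (leadingBlock c n).PosDef) :
    Subadditive fun n => -(leadingBlock c n)⁻¹.trace := by
  intro k l
  have h := trace_inv_toBlocks_add_le
    ((hpd (k + l)).submatrix (e := finSumFinEquiv) finSumFinEquiv.injective)
  have htrace : ((leadingBlock c (k + l))⁻¹.submatrix finSumFinEquiv finSumFinEquiv).trace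
      = (leadingBlock c (k + l))⁻¹.trace :=
    Equiv.sum_comp finSumFinEquiv (leadingBlock c (k + l))⁻¹.diag
  rw [toBlocks₁₁_leadingBlock_add, toBlocks₂₂_leadingBlock_add hc, inv_submatrix_equiv,
    htrace] at h
  linarith

theorem exists_tendsto_gaussianDivergence_one_add_leadingBlock
    (hpsd : ∀ n, (leadingBlock c n).PosSemidef) :
    ∃ K, Tendsto (fun n : ℕ => gaussianDivergence (1 + leadingBlock c n) / n) atTop (𝓝 K) := by
  have hc' : ∀ k i j, (1 + c) (k + i) (k + j) = (1 + c) i j := fun k i j => by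
    simp [Matrix.one_apply, hc]
  have hpd : ∀ n, (leadingBlock (1 + c) n).PosDef := fun n =>
    leadingBlock_one_add c n ▸ posDef_one_add (hpsd n)
  have htrace : ∀ n, trace (leadingBlock (1 + c) n)⁻¹ ≤ (n : ℝ) := fun n => by
    simpa [leadingBlock_one_add] using trace_inv_one_add_le_card (hpsd n)
  have hlogdet : ∀ n, 0 ≤ Real.log (leadingBlock (1 + c) n).det := fun n => by
    have h := card_sub_trace_inv_le_log_det (hpd n)
    rw [Fintype.card_fin] at h
    linarith [htrace n]
  have hlim_logdet := (subadditive_log_det_leadingBlock hc' hpd).tendsto_lim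
    ⟨0, Set.forall_mem_range.2 fun n => div_nonneg (hlogdet n) n.cast_nonneg⟩
  have hlim_trace := (subadditive_neg_trace_inv_leadingBlock hc' hpd).tendsto_lim
    ⟨-1, Set.forall_mem_range.2 fun n => by
      rw [neg_div, neg_le_neg_iff]; exact div_le_one_of_le₀ (htrace n) n.cast_nonneg⟩
  refine ⟨_, (((hlim_logdet.sub hlim_trace).sub_const 1).const_mul (1 / 2)).congr' ?_⟩
  filter_upwards [eventually_ne_atTop 0] with n hn
  rw [leadingBlock_one_add, gaussianDivergence, Fintype.card_fin]
  field_simp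
  ring

end Subadditive

end StationaryCovariance

section NeymanPearson

theorem npMissProb_map {X Y : Type*} [MeasurableSpace X] [MeasurableSpace Y] (e : X ≃ᵐ Y)
    (P0 P1 : Measure X) (α : ℝ) :
    npMissProb (P0.map e) (P1.map e) α = npMissProb P0 P1 α := by
  unfold npMissProb
  congr 1
  ext β
  constructor
  · rintro ⟨φ, ⟨hm, hφ⟩, hα, rfl⟩
    rw [integral_map_equiv] at hα
    exact ⟨φ ∘ e, ⟨hm.comp e.measurable, fun y => hφ (e y)⟩, hα, integral_map_equiv _ _⟩
  · rintro ⟨φ, ⟨hm, hφ⟩, hα, rfl⟩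
    refine ⟨φ ∘ e.symm, ⟨hm.comp e.symm.measurable, fun y => hφ (e.symm y)⟩, ?_, ?_⟩
    · rw [integral_map_equiv]; simpa using hα
    · rw [integral_map_equiv]; simp

variable {X : Type*} [MeasurableSpace X] {P0 P1 : Measure X} {L φ : X → ℝ}

theorem IsTest.integrable [IsFiniteMeasure P0] (hφ : IsTest φ) : Integrable φ P0 :=
  Integrable.of_bound hφ.1.aestronglyMeasurable 1
    (.of_forall fun y => by rw [Real.norm_of_nonneg (hφ.2 y).1]; exact (hφ.2 y).2)

theorem IsTest.one_sub (hφ : IsTest φ) : IsTest fun y => 1 - φ y :=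
  ⟨measurable_const.sub hφ.1, fun y => ⟨by linarith [(hφ.2 y).2], by linarith [(hφ.2 y).1]⟩⟩

theorem isTest_indicator_one {s : Set X} (hs : MeasurableSet s) :
    IsTest (s.indicator fun _ => 1) :=
  ⟨measurable_const.indicator hs, fun y => by by_cases hy : y ∈ s <;> simp [hy]⟩

theorem npMissProb_le {α : ℝ} (hφ : IsTest φ) (hα : ∫ y, φ y ∂P0 ≤ α) :
    npMissProb P0 P1 α ≤ ∫ y, (1 - φ y) ∂P1 := by
  refine csInf_le ⟨0, ?_⟩ ⟨φ, hφ, hα, rfl⟩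
  rintro _ ⟨ψ, hψ, -, rfl⟩
  exact integral_nonneg fun y => (hψ.one_sub.2 y).1

theorem le_npMissProb {α b : ℝ} (hα : 0 ≤ α)
    (h : ∀ φ, IsTest φ → ∫ y, φ y ∂P0 ≤ α → b ≤ ∫ y, (1 - φ y) ∂P1) : b ≤ npMissProb P0 P1 α := by
  refine le_csInf ⟨_, fun _ => 0, ⟨measurable_const, by simp⟩, by simpa using hα, rfl⟩ ?_
  rintro _ ⟨φ, hφ, hφα, rfl⟩
  exact h φ hφ hφα

/-- `L` is the log-likelihood ratio of the null hypothesis `P0` against the alternative `P1`: the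
logarithm of the density of `P0` with respect to `P1`, encoded through the density `exp (-L)` of
`P1` with respect to `P0`. -/
def IsLogLR (P0 P1 : Measure X) (L : X → ℝ) : Prop :=
  Measurable L ∧ P1 = P0.withDensity fun y => ENNReal.ofReal (Real.exp (-L y))

namespace IsLogLR

theorem integral_eq (hL : IsLogLR P0 P1 L) (g : X → ℝ) :
    ∫ y, g y ∂P1 = ∫ y, Real.exp (-L y) * g y ∂P0 := by
  have hm := hL.1
  rw [hL.2, integral_withDensity_eq_integral_toReal_smul (by fun_prop) (by simp)]
  simp only [ENNReal.toReal_ofReal (Real.exp_pos _).le, smul_eq_mul]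

theorem integrable_exp_neg_mul (hL : IsLogLR P0 P1 L) {g : X → ℝ} (hg : Integrable g P1) :
    Integrable (fun y => Real.exp (-L y) * g y) P0 := by
  have hm := hL.1
  rw [hL.2, integrable_withDensity_iff_integrable_smul' (by fun_prop) (by simp)] at hg
  simpa only [ENNReal.toReal_ofReal (Real.exp_pos _).le, smul_eq_mul] using hg

variable [IsProbabilityMeasure P0] [IsFiniteMeasure P1]

theorem npMissProb_le_exp_neg (hL : IsLogLR P0 P1 L) {c α : ℝ} (hα : P0.real {y | L y < c} ≤ α) :
    npMissProb P0 P1 α ≤ Real.exp (-c) := by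
  have hs : MeasurableSet {y | L y < c} := measurableSet_lt hL.1 measurable_const
  have hφ := isTest_indicator_one hs
  calc npMissProb P0 P1 α
      ≤ ∫ y, (1 - {y | L y < c}.indicator (fun _ => 1) y) ∂P1 :=
        npMissProb_le hφ (by simpa [integral_indicator_const _ hs] using hα)
    _ = ∫ y, Real.exp (-L y) * (1 - {y | L y < c}.indicator (fun _ => 1) y) ∂P0 :=
        hL.integral_eq _
    _ ≤ ∫ _, Real.exp (-c) ∂P0 := by
        refine integral_mono (hL.integrable_exp_neg_mul hφ.one_sub.integrable)
          (integrable_const _) fun y => ?_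
        by_cases hy : L y < c
        · simp [hy, (Real.exp_pos _).le]
        · simp [hy, not_lt.1 hy]
    _ = Real.exp (-c) := by simp

theorem exp_neg_mul_le_npMissProb (hL : IsLogLR P0 P1 L) {α : ℝ} (hα : 0 ≤ α) (c : ℝ) :
    Real.exp (-c) * (1 - α - P0.real {y | c < L y}) ≤ npMissProb P0 P1 α := by
  refine le_npMissProb hα fun φ hφ hφα => ?_
  have hs : MeasurableSet {y | c < L y} := measurableSet_lt measurable_const hL.1
  have hint : Integrable ({y | c < L y}.indicator fun _ => (1 : ℝ)) P0 :=
    (isTest_indicator_one hs).integrable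
  calc Real.exp (-c) * (1 - α - P0.real {y | c < L y})
      ≤ Real.exp (-c) * (1 - ∫ y, φ y ∂P0 - P0.real {y | c < L y}) := by gcongr
    _ = ∫ y, Real.exp (-c) * ((1 - φ y) - {y | c < L y}.indicator (fun _ => 1) y) ∂P0 := by
        rw [integral_const_mul, integral_sub hφ.one_sub.integrable hint,
          integral_sub (integrable_const _) hφ.integrable, integral_indicator_const _ hs]
        simp
    _ ≤ ∫ y, Real.exp (-L y) * (1 - φ y) ∂P0 := by
        refine integral_mono ((hφ.one_sub.integrable.sub hint).const_mul _)
          (hL.integrable_exp_neg_mul hφ.one_sub.integrable) fun y => ?_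
        obtain ⟨hφ0, hφ1⟩ := hφ.one_sub.2 y
        by_cases hy : c < L y
        · rw [Set.indicator_of_mem (by exact hy)]
          exact (mul_nonpos_of_nonneg_of_nonpos (Real.exp_pos _).le (sub_nonpos.2 hφ1)).trans
            (mul_nonneg (Real.exp_pos _).le hφ0)
        · rw [Set.indicator_of_notMem (by exact hy), sub_zero]
          gcongr
          exact not_lt.1 hy
    _ = ∫ y, (1 - φ y) ∂P1 := (hL.integral_eq _).symm

theorem abs_log_npMissProb_add_integral_le (hL : IsLogLR P0 P1 L) (hL2 : MemLp L 2 P0) {α t : ℝ}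
    (hα : α ∈ Set.Ioo 0 1) (ht : 0 < t) (hvar : Var[L; P0] ≤ min α ((1 - α) / 2) * t ^ 2) :
    |Real.log (npMissProb P0 P1 α) + ∫ y, L y ∂P0| ≤ t + Real.log (2 / (1 - α)) := by
  have hα1 : 0 < 1 - α := sub_pos.2 hα.2
  set μ := ∫ y, L y ∂P0
  have hdev : P0.real {y | t ≤ |L y - μ|} ≤ min α ((1 - α) / 2) := by
    refine (ENNReal.toReal_mono ENNReal.ofReal_ne_top
      (meas_ge_le_variance_div_sq hL2 ht)).trans ?_
    rw [ENNReal.toReal_ofReal (div_nonneg (variance_nonneg _ _) (sq_nonneg _)),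
      div_le_iff₀ (by positivity)]
    exact hvar
  have hupper : npMissProb P0 P1 α ≤ Real.exp (-(μ - t)) := by
    refine hL.npMissProb_le_exp_neg
      ((measureReal_mono fun y (hy : L y < μ - t) => ?_).trans (hdev.trans (min_le_left _ _)))
    exact (le_abs.2 (.inr (by linarith)) : t ≤ |L y - μ|)
  have hlower : Real.exp (-(μ + t)) * (2 / (1 - α))⁻¹ ≤ npMissProb P0 P1 α := by
    refine le_trans ?_ (hL.exp_neg_mul_le_npMissProb hα.1.le (μ + t))
    have htail : P0.real {y | μ + t < L y} ≤ (1 - α) / 2 := by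
      refine (measureReal_mono fun y (hy : μ + t < L y) => ?_).trans
        (hdev.trans (min_le_right _ _))
      exact (le_abs.2 (.inl (by linarith)) : t ≤ |L y - μ|)
    gcongr
    rw [inv_div]
    linarith
  have hpos : 0 < Real.exp (-(μ + t)) * (2 / (1 - α))⁻¹ := by positivity
  have hlog_upper := Real.log_le_log (hpos.trans_le hlower) hupper
  have hlog_lower := Real.log_le_log hpos hlower
  rw [Real.log_mul (Real.exp_pos _).ne' (by positivity), Real.log_inv, Real.log_exp] at hlog_lower
  rw [Real.log_exp] at hlog_upper
  have hlog_nonneg : 0 ≤ Real.log (2 / (1 - α)) :=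
    Real.log_nonneg ((one_le_div hα1).2 (by linarith [hα.1]))
  exact abs_le.2 ⟨by linarith, by linarith⟩

end IsLogLR

/-- **Stein's lemma**. -/
theorem tendsto_neg_log_npMissProb {ι : Type*} {l : Filter ι} {X : ι → Type*}
    [∀ n, MeasurableSpace (X n)] {P0 P1 : ∀ n, Measure (X n)} [∀ n, IsProbabilityMeasure (P0 n)]
    [∀ n, IsFiniteMeasure (P1 n)] {L : ∀ n, X n → ℝ} (hL : ∀ n, IsLogLR (P0 n) (P1 n) (L n))
    (hL2 : ∀ n, MemLp (L n) 2 (P0 n)) {a : ι → ℝ} (ha : Tendsto a l atTop) {V K α : ℝ}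
    (hvar : ∀ n, Var[L n; P0 n] ≤ V * a n)
    (hmean : Tendsto (fun n => (∫ y, L n y ∂P0 n) / a n) l (𝓝 K)) (hα : α ∈ Set.Ioo 0 1) :
    Tendsto (fun n => -(1 / a n) * Real.log (npMissProb (P0 n) (P1 n) α)) l (𝓝 K) := by
  set β := min α ((1 - α) / 2)
  have hβ : 0 < β := lt_min hα.1 (by linarith [hα.2])
  suffices hzero : Tendsto (fun n =>
      (Real.log (npMissProb (P0 n) (P1 n) α) + ∫ y, L n y ∂P0 n) / a n) l (𝓝 0) by
    simpa using (hmean.sub hzero).congr fun n => by ring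
  refine Metric.tendsto_nhds.2 fun ε hε => ?_
  have hconst : Tendsto (fun n => Real.log (2 / (1 - α)) / a n) l (𝓝 0) :=
    tendsto_const_nhds.div_atTop ha
  filter_upwards [ha.eventually_gt_atTop 0, ha.eventually_ge_atTop (V / (β * (ε / 2) ^ 2)),
    hconst.eventually_lt_const (half_pos hε)] with n hpos hlarge hsmall
  rw [div_le_iff₀ (by positivity)] at hlarge
  have hV : Var[L n; P0 n] ≤ β * (ε / 2 * a n) ^ 2 :=
    (hvar n).trans ((mul_le_mul_of_nonneg_right hlarge hpos.le).trans_eq (by ring))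
  rw [div_lt_iff₀ hpos] at hsmall
  rw [dist_zero_right, Real.norm_eq_abs, abs_div, abs_of_pos hpos, div_lt_iff₀ hpos]
  linarith [(hL n).abs_log_npMissProb_add_integral_le (hL2 n) hα (by positivity) hV]

end NeymanPearson

section GaussianLLR

theorem pi_withDensity {ι : Type*} [Fintype ι] {X : ι → Type*} [∀ i, MeasurableSpace (X i)]
    {μ : ∀ i, Measure (X i)} [∀ i, IsProbabilityMeasure (μ i)] {f : ∀ i, X i → ENNReal}
    (hf : ∀ i, Measurable (f i)) [∀ i, SigmaFinite ((μ i).withDensity (f i))] :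
    Measure.pi (fun i => (μ i).withDensity (f i))
      = (Measure.pi μ).withDensity fun y => ∏ i, f i (y i) := by
  refine Measure.pi_eq fun s hs => ?_
  have hindicator : (Set.univ.pi s).indicator (fun y => ∏ i, f i (y i))
      = fun y => ∏ i, (s i).indicator (f i) (y i) := by
    ext y
    by_cases hy : y ∈ Set.univ.pi s
    · rw [Set.indicator_of_mem hy]
      exact Finset.prod_congr rfl fun i _ =>
        (Set.indicator_of_mem (hy i (Set.mem_univ i)) _).symm
    · obtain ⟨i, hi⟩ : ∃ i, y i ∉ s i := by simpa [Set.mem_univ_pi] using hy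
      rw [Set.indicator_of_notMem hy,
        Finset.prod_eq_zero (Finset.mem_univ i) (Set.indicator_of_notMem hi _)]
  have hmeas : ∀ i, Measurable ((s i).indicator (f i)) := fun i => (hf i).indicator (hs i)
  calc (Measure.pi μ).withDensity (fun y => ∏ i, f i (y i)) (Set.univ.pi s)
      = ∫⁻ y, ∏ i, (s i).indicator (f i) (y i) ∂Measure.pi μ := by
        rw [withDensity_apply _ (.univ_pi hs), ← lintegral_indicator (.univ_pi hs), hindicator]
    _ = ∏ i, ∫⁻ y, (s i).indicator (f i) (y i) ∂Measure.pi μ :=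
        lintegral_prod_eq_prod_lintegral_of_indepFun Finset.univ
          (fun i (y : ∀ i, X i) => (s i).indicator (f i) (y i))
          (iIndepFun_pi fun i => (hmeas i).aemeasurable)
          fun i => (hmeas i).comp (measurable_pi_apply i)
    _ = ∏ i, (μ i).withDensity (f i) (s i) := by
        refine Finset.prod_congr rfl fun i _ => ?_
        rw [(measurePreserving_eval μ i).lintegral_comp (hmeas i), lintegral_indicator (hs i),
          withDensity_apply _ (hs i)]

theorem IsLogLR.pi {ι : Type*} [Fintype ι] {X : ι → Type*} [∀ i, MeasurableSpace (X i)]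
    {P0 P1 : ∀ i, Measure (X i)} [∀ i, IsProbabilityMeasure (P0 i)] [∀ i, SigmaFinite (P1 i)]
    {L : ∀ i, X i → ℝ} (hL : ∀ i, IsLogLR (P0 i) (P1 i) (L i)) :
    IsLogLR (Measure.pi P0) (Measure.pi P1) fun y => ∑ i, L i (y i) := by
  have hmeas := fun i => (hL i).1
  have hdensity := fun i => (hL i).2
  refine ⟨by fun_prop, ?_⟩
  have hsigma : ∀ i, SigmaFinite
      ((P0 i).withDensity fun y => ENNReal.ofReal (Real.exp (-L i y))) := fun i =>
    hdensity i ▸ inferInstance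
  rw [funext hdensity, pi_withDensity fun i => by fun_prop]
  congr 1
  ext y
  rw [← ENNReal.ofReal_prod_of_nonneg fun i _ => (Real.exp_pos _).le, ← Real.exp_sum,
    Finset.sum_neg_distrib]

/-- The log-likelihood ratio of `N(0, 1)` against `N(0, v)`. -/
noncomputable def gaussianLLR (v : ℝ≥0) (z : ℝ) : ℝ :=
  1 / 2 * Real.log v - 1 / 2 * (1 - (v : ℝ)⁻¹) * z ^ 2

theorem exp_neg_gaussianLLR {v : ℝ≥0} (hv : v ≠ 0) (z : ℝ) :
    Real.exp (-gaussianLLR v z)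
      = (√(v : ℝ))⁻¹ * Real.exp (1 / 2 * (1 - (v : ℝ)⁻¹) * z ^ 2) := by
  rw [gaussianLLR, neg_sub, sub_eq_neg_add, Real.exp_add, Real.exp_neg, Real.sqrt_eq_rpow,
    Real.rpow_def_of_pos (by positivity), mul_comm (Real.log _)]

theorem gaussianPDFReal_mul_exp_neg_gaussianLLR {v : ℝ≥0} (hv : v ≠ 0) (z : ℝ) :
    gaussianPDFReal 0 1 z * Real.exp (-gaussianLLR v z) = gaussianPDFReal 0 v z := by
  have hexponent : Real.exp (-(z - 0) ^ 2 / (2 * v))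
      = Real.exp (-(z - 0) ^ 2 / (2 * 1)) * Real.exp (1 / 2 * (1 - (v : ℝ)⁻¹) * z ^ 2) := by
    rw [← Real.exp_add]
    congr 1
    field_simp
    ring
  rw [exp_neg_gaussianLLR hv, gaussianPDFReal, gaussianPDFReal, hexponent,
    Real.sqrt_mul (by positivity) (v : ℝ), NNReal.coe_one, mul_one, mul_inv]
  ring

theorem isLogLR_gaussianLLR {v : ℝ≥0} (hv : v ≠ 0) :
    IsLogLR (gaussianReal 0 1) (gaussianReal 0 v) (gaussianLLR v) := by
  have hmeas : Measurable (gaussianLLR v) := by unfold gaussianLLR; fun_prop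
  refine ⟨hmeas, ?_⟩
  rw [gaussianReal_of_var_ne_zero _ hv, gaussianReal_of_var_ne_zero _ one_ne_zero,
    ← withDensity_mul _ (measurable_gaussianPDF 0 1) (by fun_prop)]
  congr 1
  ext z
  rw [Pi.mul_apply, gaussianPDF, gaussianPDF, ← ENNReal.ofReal_mul (gaussianPDFReal_nonneg _ _ _),
    gaussianPDFReal_mul_exp_neg_gaussianLLR hv]

theorem memLp_sq_gaussianReal (μ : ℝ) (v : ℝ≥0) :
    MemLp (fun z : ℝ => z ^ 2) 2 (gaussianReal μ v) := by
  rw [memLp_two_iff_integrable_sq (by fun_prop)]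
  simpa [← pow_mul, Even.pow_abs (by decide : Even 4)] using
    (memLp_id_gaussianReal (μ := μ) (v := v) 4).integrable_norm_pow (by norm_num)

theorem memLp_gaussianLLR (v : ℝ≥0) : MemLp (gaussianLLR v) 2 (gaussianReal 0 1) :=
  (memLp_const _).sub ((memLp_sq_gaussianReal 0 1).const_mul _)

theorem integral_gaussianLLR (v : ℝ≥0) :
    ∫ z, gaussianLLR v z ∂gaussianReal 0 1 = 1 / 2 * (Real.log v - (1 - (v : ℝ)⁻¹)) := by
  have hsq : ∫ z : ℝ, z ^ 2 ∂gaussianReal 0 1 = 1 := by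
    have h := variance_fun_id_gaussianReal (μ := 0) (v := 1)
    rwa [variance_of_integral_eq_zero (by fun_prop) (by simp), NNReal.coe_one] at h
  simp only [gaussianLLR]
  rw [integral_sub (integrable_const _)
    (((memLp_sq_gaussianReal 0 1).integrable (by norm_num)).const_mul _),
    integral_const_mul _ fun z : ℝ => z ^ 2, hsq, integral_const, probReal_univ, one_smul]
  ring

theorem variance_gaussianLLR_le {v : ℝ≥0} (hv : 1 ≤ v) :
    Var[gaussianLLR v; gaussianReal 0 1] ≤ Var[fun z : ℝ => z ^ 2; gaussianReal 0 1] := by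
  have hinv : (v : ℝ)⁻¹ ≤ 1 := inv_le_one_of_one_le₀ (by exact_mod_cast hv)
  have hinv0 : 0 ≤ (v : ℝ)⁻¹ := by positivity
  unfold gaussianLLR
  rw [variance_const_sub (by fun_prop), variance_const_mul]
  exact mul_le_of_le_one_left (variance_nonneg _ _) (by nlinarith)

variable {ι : Type*} [Fintype ι]

theorem isLogLR_sum_gaussianLLR {v : ι → ℝ≥0} (hv : ∀ i, v i ≠ 0) :
    IsLogLR (Measure.pi fun _ => gaussianReal 0 1) (Measure.pi fun i => gaussianReal 0 (v i))
      fun z => ∑ i, gaussianLLR (v i) (z i) :=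
  .pi fun i => isLogLR_gaussianLLR (hv i)

theorem memLp_gaussianLLR_eval (v : ℝ≥0) (i : ι) :
    MemLp (fun z : ι → ℝ => gaussianLLR v (z i)) 2 (Measure.pi fun _ => gaussianReal 0 1) :=
  (memLp_gaussianLLR v).comp_measurePreserving (measurePreserving_eval _ i)

theorem memLp_sum_gaussianLLR (v : ι → ℝ≥0) :
    MemLp (fun z : ι → ℝ => ∑ i, gaussianLLR (v i) (z i)) 2
      (Measure.pi fun _ => gaussianReal 0 1) :=
  memLp_finsetSum Finset.univ fun i _ => memLp_gaussianLLR_eval (v i) i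

theorem integral_sum_gaussianLLR [DecidableEq ι] {v : ι → ℝ≥0} (hv : ∀ i, v i ≠ 0) :
    ∫ z, ∑ i, gaussianLLR (v i) (z i) ∂(Measure.pi fun _ : ι => gaussianReal 0 1)
      = gaussianDivergence (Matrix.diagonal fun i => (v i : ℝ)) := by
  rw [integral_finsetSum _ fun i _ => (memLp_gaussianLLR_eval (v i) i).integrable (by norm_num),
    gaussianDivergence_diagonal fun i => NNReal.coe_ne_zero.2 (hv i)]
  refine Finset.sum_congr rfl fun i _ => ?_
  rw [← integral_gaussianLLR]
  exact integral_comp_eval (μ := fun _ : ι => gaussianReal 0 1)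
    (memLp_gaussianLLR (v i)).aestronglyMeasurable

theorem variance_sum_gaussianLLR_le {v : ι → ℝ≥0} (hv : ∀ i, 1 ≤ v i) :
    Var[fun z : ι → ℝ => ∑ i, gaussianLLR (v i) (z i); Measure.pi fun _ => gaussianReal 0 1]
      ≤ Var[fun z : ℝ => z ^ 2; gaussianReal 0 1] * Fintype.card ι := by
  calc Var[fun z : ι → ℝ => ∑ i, gaussianLLR (v i) (z i); Measure.pi fun _ => gaussianReal 0 1]
      = ∑ i, Var[gaussianLLR (v i); gaussianReal 0 1] := by
        rw [← variance_sum_pi (μ := fun _ : ι => gaussianReal 0 1)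
          fun i => memLp_gaussianLLR (v i), Finset.sum_fn]
    _ ≤ ∑ _ : ι, Var[fun z : ℝ => z ^ 2; gaussianReal 0 1] :=
        Finset.sum_le_sum fun i _ => variance_gaussianLLR_le (hv i)
    _ = Var[fun z : ℝ => z ^ 2; gaussianReal 0 1] * Fintype.card ι := by
        rw [Finset.sum_const, Finset.card_univ, nsmul_eq_mul, mul_comm]

end GaussianLLR

section MultivariateGaussian

open Matrix

variable {ι : Type*} [Fintype ι] [DecidableEq ι]

theorem map_toLp_pi_gaussianReal (v : ι → ℝ≥0) :
    (Measure.pi fun i => gaussianReal 0 (v i)).map (WithLp.toLp 2)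
      = multivariateGaussian 0 (diagonal fun i => (v i : ℝ)) := by
  have hpsd : (diagonal fun i => (v i : ℝ)).PosSemidef := .diagonal fun i => (v i).coe_nonneg
  refine Measure.ext_of_charFun (funext fun t => ?_)
  simp only [charFun_pi, charFun_gaussianReal, charFun_multivariateGaussian hpsd, ← Complex.exp_sum,
    dotProduct, mulVec_diagonal, inner_zero_right, Complex.ofReal_zero, zero_mul, mul_zero,
    zero_sub, Complex.ofReal_sum, Finset.sum_div, ← Finset.sum_neg_distrib]
  congr 1
  refine Finset.sum_congr rfl fun i _ => ?_
  push_cast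
  ring

theorem multivariateGaussian_conv {μ ν : EuclideanSpace ℝ ι} {S T : Matrix ι ι ℝ}
    (hS : S.PosSemidef) (hT : T.PosSemidef) :
    multivariateGaussian μ S ∗ multivariateGaussian ν T = multivariateGaussian (μ + ν) (S + T) := by
  refine Measure.ext_of_charFun (funext fun t => ?_)
  rw [charFun_conv, charFun_multivariateGaussian hS, charFun_multivariateGaussian hT,
    charFun_multivariateGaussian (hS.add hT), ← Complex.exp_add, inner_add_right, add_mulVec,
    dotProduct_add]
  push_cast
  ring_nf

theorem multivariateGaussian_map_toEuclideanCLM {μ : EuclideanSpace ℝ ι} {S : Matrix ι ι ℝ}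
    (hS : S.PosSemidef) (G : Matrix ι ι ℝ) :
    (multivariateGaussian μ S).map (toEuclideanCLM (𝕜 := ℝ) G)
      = multivariateGaussian (toEuclideanCLM (𝕜 := ℝ) G μ) (G * S * Gᵀ) := by
  have hGS : (G * S * Gᵀ).PosSemidef := hS.mul_mul_conjTranspose_same G
  have hadjoint (x t : EuclideanSpace ℝ ι) :
      inner ℝ (toEuclideanCLM (𝕜 := ℝ) G x) t = inner ℝ x (WithLp.toLp 2 (Gᵀ *ᵥ t.ofLp)) := by
    simp [EuclideanSpace.inner_eq_star_dotProduct, dotProduct_mulVec, mulVec_transpose]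
  refine Measure.ext_of_charFun (funext fun t => ?_)
  calc charFun ((multivariateGaussian μ S).map (toEuclideanCLM (𝕜 := ℝ) G)) t
      = charFun (multivariateGaussian μ S) (WithLp.toLp 2 (Gᵀ *ᵥ t.ofLp)) := by
        rw [charFun_apply, charFun_apply, integral_map (by fun_prop) (by fun_prop)]
        simp_rw [hadjoint]
    _ = charFun (multivariateGaussian (toEuclideanCLM (𝕜 := ℝ) G μ) (G * S * Gᵀ)) t := by
        rw [charFun_multivariateGaussian hS, charFun_multivariateGaussian hGS,
          real_inner_comm, ← hadjoint, real_inner_comm, ← mulVec_mulVec, ← mulVec_mulVec,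
          dotProduct_mulVec _ G, ← mulVec_transpose]

theorem npMissProb_multivariateGaussian_conj {S T G : Matrix ι ι ℝ} (hS : S.PosSemidef)
    (hT : T.PosSemidef) (hG : IsUnit G) (α : ℝ) :
    npMissProb (multivariateGaussian 0 (G * S * Gᵀ)) (multivariateGaussian 0 (G * T * Gᵀ)) α
      = npMissProb (multivariateGaussian 0 S) (multivariateGaussian 0 T) α := by
  let e := ContinuousLinearEquiv.ofUnit (hG.map (toEuclideanCLM (n := ι) (𝕜 := ℝ))).unit
  have hmap {R : Matrix ι ι ℝ} (hR : R.PosSemidef) : multivariateGaussian 0 (G * R * Gᵀ)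
      = (multivariateGaussian 0 R).map e.toHomeomorph.toMeasurableEquiv := by
    have h := multivariateGaussian_map_toEuclideanCLM (μ := 0) hR G
    rw [map_zero] at h
    exact h.symm
  rw [hmap hS, hmap hT, npMissProb_map]

theorem map_toLp_lawH0 (σ2 : ℝ≥0) :
    (lawH0 ι σ2).map (WithLp.toLp 2) = multivariateGaussian 0 ((σ2 : ℝ) • 1) := by
  rw [lawH0, map_toLp_pi_gaussianReal, smul_one_eq_diagonal]

theorem map_toLp_lawH1 {A : ℝ} (hA : 0 ≤ A) (Pi0 σ2 : ℝ≥0) (x : ι → ℝ) :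
    (lawH1 A Pi0 σ2 x).map (WithLp.toLp 2)
      = multivariateGaussian 0 (signalCov A Pi0 x + (σ2 : ℝ) • 1) := by
  have hsignal : (signalLaw A Pi0 x).map (WithLp.toLp 2)
      = multivariateGaussian 0 (signalCov A Pi0 x) := by
    rw [signalLaw, Measure.map_map (by fun_prop) (by fun_prop)]
    exact Measure.map_id
  have : IsProbabilityMeasure (signalLaw A Pi0 x) :=
    Measure.isProbabilityMeasure_map (by fun_prop)
  have : IsProbabilityMeasure (lawH0 ι σ2) := by unfold lawH0; infer_instance
  have hnoise : ((σ2 : ℝ) • (1 : Matrix ι ι ℝ)).PosSemidef := .smul .one σ2.coe_nonneg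
  rw [← add_zero (0 : EuclideanSpace ℝ ι),
    ← multivariateGaussian_conv (posSemidef_signalCov hA Pi0 x) hnoise, ← hsignal, ← map_toLp_lawH0,
    Measure.conv, Measure.map_prod_map _ _ (by fun_prop) (by fun_prop), lawH1,
    Measure.map_map (by fun_prop) (by fun_prop), Measure.map_map (by fun_prop) (by fun_prop)]
  rfl

theorem signalCov_add_smul_one {κ : Type*} [DecidableEq κ] (A : ℝ) (Pi0 : ℝ≥0) {σ2 : ℝ≥0}
    (hσ : σ2 ≠ 0) (x : κ → ℝ) :
    signalCov A Pi0 x + (σ2 : ℝ) • (1 : Matrix κ κ ℝ)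
      = (σ2 : ℝ) • (1 + signalCov A (Pi0 / σ2) x) := by
  have hσ' : (σ2 : ℝ) ≠ 0 := NNReal.coe_ne_zero.2 hσ
  ext i j
  simp only [signalCov, Matrix.add_apply, Matrix.smul_apply, of_apply, smul_eq_mul, NNReal.coe_div]
  field_simp
  ring

theorem missProb_eq_npMissProb_multivariateGaussian {A : ℝ} (hA : 0 ≤ A) (Pi0 : ℝ≥0) {σ2 : ℝ≥0}
    (hσ : σ2 ≠ 0) (x : ι → ℝ) (α : ℝ) :
    missProb A Pi0 σ2 x α = npMissProb (multivariateGaussian 0 1)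
      (multivariateGaussian 0 (1 + signalCov A (Pi0 / σ2) x)) α := by
  have hσ_pos : (0 : ℝ) < σ2 := by positivity
  have hscale (R : Matrix ι ι ℝ) :
      (√(σ2 : ℝ) • (1 : Matrix ι ι ℝ)) * R * (√(σ2 : ℝ) • (1 : Matrix ι ι ℝ))ᵀ
        = (σ2 : ℝ) • R := by
    simp [smul_smul, Real.mul_self_sqrt hσ_pos.le]
  have hunit : IsUnit (√(σ2 : ℝ) • (1 : Matrix ι ι ℝ)) :=
    isUnit_one.smul (Units.mk0 _ (Real.sqrt_pos.2 hσ_pos).ne')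
  have hpsd := (posDef_one_add (posSemidef_signalCov hA (Pi0 / σ2) x)).posSemidef
  rw [← npMissProb_multivariateGaussian_conj .one hpsd hunit, hscale, hscale,
    ← signalCov_add_smul_one A Pi0 hσ, ← map_toLp_lawH0, ← map_toLp_lawH1 hA]
  exact (npMissProb_map (MeasurableEquiv.toLp 2 (ι → ℝ)) _ _ α).symm

theorem gaussianDivergence_conj {G : Matrix ι ι ℝ} (hG : IsUnit G) (S : Matrix ι ι ℝ) :
    gaussianDivergence (G * S * G⁻¹) = gaussianDivergence S := by
  have hG_det : IsUnit G.det := (isUnit_iff_isUnit_det G).1 hG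
  rw [gaussianDivergence, gaussianDivergence, det_conj hG, Matrix.mul_inv_rev, Matrix.mul_inv_rev,
    nonsing_inv_nonsing_inv _ hG_det, trace_mul_comm, nonsing_inv_mul_cancel_right _ _ hG_det]

theorem eigenvectorUnitary_mul_transpose {S : Matrix ι ι ℝ} (hS : S.IsHermitian) :
    (hS.eigenvectorUnitary : Matrix ι ι ℝ) * (hS.eigenvectorUnitary : Matrix ι ι ℝ)ᵀ = 1 :=
  Unitary.mul_star_self_of_mem hS.eigenvectorUnitary.2

theorem eq_conj_diagonal_eigenvalues {S : Matrix ι ι ℝ} (hS : S.IsHermitian) :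
    S = (hS.eigenvectorUnitary : Matrix ι ι ℝ) * diagonal hS.eigenvalues
      * (hS.eigenvectorUnitary : Matrix ι ι ℝ)ᵀ := by
  conv_lhs => rw [hS.spectral_theorem]
  rfl

theorem gaussianDivergence_diagonal_eigenvalues {S : Matrix ι ι ℝ} (hS : S.IsHermitian) :
    gaussianDivergence (diagonal hS.eigenvalues) = gaussianDivergence S := by
  have hU := eigenvectorUnitary_mul_transpose hS
  conv_rhs => rw [eq_conj_diagonal_eigenvalues hS, ← inv_eq_right_inv hU]
  exact (gaussianDivergence_conj (.of_mul_eq_one _ hU) _).symm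

theorem one_le_eigenvalues_one_add {X : Matrix ι ι ℝ} (hX : X.PosSemidef)
    (hS : (1 + X).IsHermitian) (i : ι) : 1 ≤ hS.eigenvalues i := by
  set u := (hS.eigenvectorBasis i).ofLp
  have hunit : star u ⬝ᵥ u = 1 := by
    rw [dotProduct_comm, ← EuclideanSpace.inner_eq_star_dotProduct, real_inner_self_eq_norm_sq,
      hS.eigenvectorBasis.norm_eq_one, one_pow]
  calc 1 ≤ 1 + star u ⬝ᵥ X *ᵥ u := le_add_of_nonneg_right (hX.dotProduct_mulVec_nonneg u)
    _ = star u ⬝ᵥ (1 + X) *ᵥ u := by rw [add_mulVec, one_mulVec, dotProduct_add, hunit]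
    _ = hS.eigenvalues i := (hS.eigenvalues_eq i).symm

theorem npMissProb_multivariateGaussian_one_eq_pi {S : Matrix ι ι ℝ} (hS : S.PosSemidef) (α : ℝ) :
    npMissProb (multivariateGaussian 0 1) (multivariateGaussian 0 S) α
      = npMissProb (Measure.pi fun _ => gaussianReal 0 1)
        (Measure.pi fun i => gaussianReal 0 (hS.1.eigenvalues i).toNNReal) α := by
  set U := (hS.1.eigenvectorUnitary : Matrix ι ι ℝ)
  have hU : U * Uᵀ = 1 := eigenvectorUnitary_mul_transpose hS.1
  have hone : multivariateGaussian (0 : EuclideanSpace ℝ ι) 1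
      = multivariateGaussian 0 (U * 1 * Uᵀ) := by
    rw [Matrix.mul_one, hU]
  have hdiagonal : (diagonal fun i => ((hS.1.eigenvalues i).toNNReal : ℝ))
      = diagonal hS.1.eigenvalues := by
    simp only [Real.coe_toNNReal _ (hS.eigenvalues_nonneg _)]
  have hdiagonal_one : (diagonal fun _ : ι => ((1 : ℝ≥0) : ℝ)) = 1 := by simp
  conv_lhs => rw [eq_conj_diagonal_eigenvalues hS.1, hone]
  rw [npMissProb_multivariateGaussian_conj .one (.diagonal hS.eigenvalues_nonneg)
      (.of_mul_eq_one _ hU), ← hdiagonal, ← hdiagonal_one, ← map_toLp_pi_gaussianReal,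
    ← map_toLp_pi_gaussianReal]
  exact npMissProb_map (MeasurableEquiv.toLp 2 (ι → ℝ)) _ _ α

theorem tendsto_neg_log_npMissProb_multivariateGaussian {κ : Type*} {l : Filter κ}
    {ι : κ → Type*} [∀ n, Fintype (ι n)] [∀ n, DecidableEq (ι n)]
    {X : ∀ n, Matrix (ι n) (ι n) ℝ} (hX : ∀ n, (X n).PosSemidef)
    (hcard : Tendsto (fun n => (Fintype.card (ι n) : ℝ)) l atTop) {K α : ℝ}
    (hK : Tendsto (fun n => gaussianDivergence (1 + X n) / Fintype.card (ι n)) l (𝓝 K))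
    (hα : α ∈ Set.Ioo 0 1) :
    Tendsto (fun n => -(1 / (Fintype.card (ι n) : ℝ)) * Real.log
      (npMissProb (multivariateGaussian 0 1) (multivariateGaussian 0 (1 + X n)) α)) l (𝓝 K) := by
  have hS : ∀ n, (1 + X n).PosSemidef := fun n => (posDef_one_add (hX n)).posSemidef
  let v (n : κ) (i : ι n) : ℝ≥0 := ((hS n).1.eigenvalues i).toNNReal
  have hv : ∀ n i, 1 ≤ v n i := fun n i =>
    Real.one_le_toNNReal.2 (one_le_eigenvalues_one_add (hX n) (hS n).1 i)
  have hv0 : ∀ n i, v n i ≠ 0 := fun n i => (zero_lt_one.trans_le (hv n i)).ne'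
  have hmean (n : κ) : gaussianDivergence (1 + X n)
      = ∫ z, ∑ i, gaussianLLR (v n i) (z i) ∂(Measure.pi fun _ => gaussianReal 0 1) := by
    rw [integral_sum_gaussianLLR (hv0 n), ← gaussianDivergence_diagonal_eigenvalues (hS n).1]
    simp only [v, Real.coe_toNNReal _ ((hS n).eigenvalues_nonneg _)]
  simp only [hmean] at hK
  simp only [npMissProb_multivariateGaussian_one_eq_pi (hS _)]
  exact tendsto_neg_log_npMissProb (fun n => isLogLR_sum_gaussianLLR (hv0 n))
    (fun n => memLp_sum_gaussianLLR (v n)) hcard (fun n => variance_sum_gaussianLLR_le (hv n)) hK hα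

end MultivariateGaussian

section ErrorExponents

open Matrix

theorem tendsto_neg_log_missProb {κ : Type*} {l : Filter κ} {ι : κ → Type*}
    [∀ n, Fintype (ι n)] [∀ n, DecidableEq (ι n)] {A : ℝ} (hA : 0 ≤ A) {Pi0 σ2 : ℝ≥0}
    (hσ : σ2 ≠ 0) {x : ∀ n, ι n → ℝ}
    (hcard : Tendsto (fun n => (Fintype.card (ι n) : ℝ)) l atTop) {K α : ℝ}
    (hK : Tendsto (fun n => gaussianDivergence (1 + signalCov A (Pi0 / σ2) (x n))
      / Fintype.card (ι n)) l (𝓝 K)) (hα : α ∈ Set.Ioo 0 1) :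
    Tendsto (fun n => -(1 / (Fintype.card (ι n) : ℝ)) * Real.log (missProb A Pi0 σ2 (x n) α))
      l (𝓝 K) := by
  simp only [missProb_eq_npMissProb_multivariateGaussian hA Pi0 hσ]
  exact tendsto_neg_log_npMissProb_multivariateGaussian
    (fun n => posSemidef_signalCov hA _ (x n)) hcard hK hα

theorem exists_tendsto_gaussianDivergence_uniformLoc {A : ℝ} (hA : 0 ≤ A) (Δ : ℝ) (r : ℝ≥0) :
    ∃ K, Tendsto (fun n : ℕ => gaussianDivergence (1 + signalCov A r (uniformLoc Δ n)) / n)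
      atTop (𝓝 K) := by
  have hstationary (k i j : ℕ) : signalCov A r (fun n : ℕ => n * Δ) (k + i) (k + j)
      = signalCov A r (fun n : ℕ => n * Δ) i j := by
    simp only [signalCov, of_apply]
    push_cast
    ring_nf
  have hblock (n : ℕ) : leadingBlock (signalCov A r fun n : ℕ => n * Δ) n
      = signalCov A r (uniformLoc Δ n) := rfl
  simpa only [hblock] using exists_tendsto_gaussianDivergence_one_add_leadingBlock hstationary
    fun n => hblock n ▸ posSemidef_signalCov hA r (uniformLoc Δ n)

theorem gaussianDivergence_one_add_signalCov_clusterLoc {A : ℝ} (hA : 0 ≤ A) (Δ : ℝ) (r : ℝ≥0)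
    (N M : ℕ) : gaussianDivergence (1 + signalCov A r (clusterLoc Δ N M))
      = gaussianDivergence (1 + signalCov A (M * r) (uniformLoc Δ N)) := by
  let B : Matrix (Fin N × Fin M) (Fin N) ℝ := of fun k i => if k.1 = i then 1 else 0
  let C : Matrix (Fin N) (Fin N × Fin M) ℝ := of fun i k => signalCov A r (uniformLoc Δ N) i k.1
  have hBC : B * C = signalCov A r (clusterLoc Δ N M) := by
    ext k l
    simp [B, C, mul_apply, signalCov, clusterLoc, uniformLoc]
  have hCB : C * B = signalCov A (M * r) (uniformLoc Δ N) := by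
    ext i j
    simp [B, C, mul_apply, signalCov, uniformLoc, Fintype.sum_prod_type, mul_assoc]
  rw [← hBC, ← hCB, gaussianDivergence_one_add_mul_comm]
  rw [hCB]
  exact (posDef_one_add (posSemidef_signalCov hA _ _)).det_pos.ne'.isUnit

theorem isUniformExponent_of_tendsto_gaussianDivergence {A : ℝ} (hA : 0 ≤ A) {Pi0 σ2 : ℝ≥0}
    (hσ : σ2 ≠ 0) {Δ K α : ℝ} (hα : α ∈ Set.Ioo 0 1)
    (hK : Tendsto (fun n : ℕ => gaussianDivergence
      (1 + signalCov A (Pi0 / σ2) (uniformLoc Δ n)) / n) atTop (𝓝 K)) :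
    IsUniformExponent A Pi0 σ2 Δ α K := by
  simpa [IsUniformExponent] using tendsto_neg_log_missProb hA hσ (x := uniformLoc Δ)
    (by simpa using tendsto_natCast_atTop_atTop) (by simpa using hK) hα

theorem isClusterExponent_of_tendsto_gaussianDivergence {A : ℝ} (hA : 0 ≤ A) {Pi0 σ2 : ℝ≥0}
    (hσ : σ2 ≠ 0) {M : ℕ} (hM : M ≠ 0) {Δ K α : ℝ} (hα : α ∈ Set.Ioo 0 1)
    (hK : Tendsto (fun N : ℕ => gaussianDivergence
      (1 + signalCov A (M * (Pi0 / σ2)) (uniformLoc Δ N)) / N) atTop (𝓝 K)) :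
    IsClusterExponent A Pi0 σ2 M Δ α (1 / M * K) := by
  have hcard (N : ℕ) : (Fintype.card (Fin N × Fin M) : ℝ) = M * N := by simp [mul_comm]
  have hlimit := tendsto_neg_log_missProb hA (Pi0 := Pi0) hσ (l := atTop) (K := 1 / M * K)
    (x := fun N => clusterLoc Δ N M) (α := α) ?_ ?_ hα
  · simpa only [IsClusterExponent, hcard] using hlimit
  · simp only [hcard]
    exact tendsto_natCast_atTop_atTop.const_mul_atTop (by positivity)
  · simp only [hcard, gaussianDivergence_one_add_signalCov_clusterLoc hA]
    exact (hK.const_mul (1 / (M : ℝ))).congr fun N => by ring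

end ErrorExponents

end SensorField

theorem mainTheorem1 (A : ℝ) (hA : 0 ≤ A) :
    ∃ K : ℝ → ℝ → ℝ,
      -- `K Δ snr` is the exponent of uniform configuration, whatever the level
      (∀ (Δ : ℝ) (Pi0 σ2 : ℝ≥0) (α : ℝ), 0 < Δ → 0 < σ2 → α ∈ Set.Ioo (0 : ℝ) 1 →
        SensorField.IsUniformExponent A Pi0 σ2 Δ α (K Δ ((Pi0 : ℝ) / (σ2 : ℝ)))) ∧
      -- the exponent of periodic clustering
      (∀ (M : ℕ) (Δ : ℝ) (Pi0 σ2 : ℝ≥0) (α : ℝ), 1 ≤ M → 0 < Δ → 0 < σ2 →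
        α ∈ Set.Ioo (0 : ℝ) 1 →
        SensorField.IsClusterExponent A Pi0 σ2 M ((M : ℝ) * Δ) α
          (1 / (M : ℝ) * K ((M : ℝ) * Δ) ((M : ℝ) * ((Pi0 : ℝ) / (σ2 : ℝ))))) := by
  choose K hK using fun (Δ : ℝ) (r : ℝ≥0) =>
    SensorField.exists_tendsto_gaussianDivergence_uniformLoc hA Δ r
  refine ⟨fun Δ s => K Δ s.toNNReal, fun Δ Pi0 σ2 α _ hσ hα => ?_,
    fun M Δ Pi0 σ2 α hM _ hσ hα => ?_⟩
  · have hsnr : ((Pi0 : ℝ) / σ2).toNNReal = Pi0 / σ2 := by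
      rw [← NNReal.coe_div, Real.toNNReal_coe]
    beta_reduce
    rw [hsnr]
    exact SensorField.isUniformExponent_of_tendsto_gaussianDivergence hA hσ.ne' hα (hK _ _)
  · have hsnr : ((M : ℝ) * ((Pi0 : ℝ) / σ2)).toNNReal = M * (Pi0 / σ2) := by
      rw [← NNReal.coe_div, ← NNReal.coe_natCast, ← NNReal.coe_mul, Real.toNNReal_coe]
    beta_reduce
    rw [hsnr]
    exact SensorField.isClusterExponent_of_tendsto_gaussianDivergence hA hσ.ne'
      (Nat.one_le_iff_ne_zero.1 hM) hα (hK _ _)
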